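/- All rings are commutative with $1$. Let $R$ be a ring, $n\ge 0$, and let $A$ be an $R$-algebra of rank $n$, i.e. the unit ideal of $R$ is generated by the elements $r$ such that $A_r$ is free of rank $n$ as an $R_r$-module. Tensor powers are over the base ring; $(A^{\otimes n})^{S_n}$ denotes the $R$-algebra of tensors invariant under permutation of the $n$ factors. For $a\in A$ let $e_k(a)\in (A^{\otimes n})^{S_n}$ be the $k$-th elementary symmetric polynomial evaluated at $a^{(i)}=1\otimes\dots\otimes a\otimes\dots\otimes 1$ ($a$ in the $i$-th place), $1\le i\le n$. For an algebra $B$ of rank $n$ over a ring $S$, the norm $N_{B/S}(b)$ of $b\in B$ is the element $s\in S$ with $(bb_1)\wedge\dots\wedge(bb_n)=s\,(b_1\wedge\dots\wedge b_n)$ in $\bigwedge^n_S B$ for all $b_1,\dots,b_n\in B$. For $a\in A$ let $s_k(a)\in R$ be the coefficient of $(-1)^kx^{n-k}$ in the characteristic polynomial $N_{A[x]/R[x]}(x-a)$ of $a$. The Ferrand homomorphism of $A$ over $R$ is the $R$-algebra homomorphism $\varphi\colon (A^{\otimes n})^{S_n}\to R$ that corresponds to the norm as a polynomial law: for every $R$-algebra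 $R'$, with $A'=R'\otimes_R A$, there is an $R'$-algebra homomorphism $\varphi'\colon (A'^{\otimes n})^{S_n}\to R'$ that takes the value $\varphi(\alpha)\cdot 1_{R'}$ on the image of each $\alpha\in (A^{\otimes n})^{S_n}$ and satisfies $\varphi'(a'\otimes\dots\otimes a')=N_{A'/R'}(a')$ for all $a'\in A'$. Then each $a\in A$ has a unique characteristic polynomial, the Ferrand homomorphism of $A$ over $R$ exists and is unique, it satisfies $\varphi(e_k(a))=s_k(a)$ for all $a\in A$ and $1\le k\le n$, and it is the only $R$-algebra homomorphism $(A^{\otimes n})^{S_n}\to R$ that does so. -/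

import Mathlib

open scoped TensorProduct Polynomial ExteriorAlgebra

universe u v w

noncomputable section

namespace Ferrand

/-- An `R`-module `M` is locally free of rank `n` if the unit ideal of `R` is generated by the set
of all `r` such that `M_r` is free of rank `n` over `R_r`. (The rank is expressed through a basis
indexed by `Fin n`, which is also correct over the zero ring.) -/
def LocallyFreeOfRank (R : Type u) [CommRing R] (M : Type v) [AddCommGroup M] [Module R M]
    (n : ℕ) : Prop :=
  Ideal.span {r : R | Nonempty (Module.Basis (Fin n) (Localization.Away r)
    (LocalizedModule (Submonoid.powers r) M))} = ⊤

/-- The `n`-fold tensor power of `A` over `R`, a commutative `R`-algebra. -/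
abbrev TPow (R : Type u) [CommRing R] (A : Type v) [CommRing A] [Algebra R A] (n : ℕ) :
    Type (max u v) :=
  ⨂[R] _ : Fin n, A

section TensorPower

variable (R : Type u) [CommRing R] (A : Type v) [CommRing A] [Algebra R A] (n : ℕ)

/-- The action of a permutation on the tensor power by permuting the tensor factors:
`a₁ ⊗ ⋯ ⊗ aₙ ↦ a_{σ 1} ⊗ ⋯ ⊗ a_{σ n}`. -/
def perm (σ : Equiv.Perm (Fin n)) : TPow R A n →ₐ[R] TPow R A n :=
  PiTensorProduct.liftAlgHom ((PiTensorProduct.tprod R (s := fun _ : Fin n => A)).domDomCongr σ)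
    rfl (fun x y => by
      simp only [MultilinearMap.domDomCongr_apply, PiTensorProduct.tprod_mul_tprod]
      rfl)

@[simp] theorem perm_tprod (σ : Equiv.Perm (Fin n)) (a : Fin n → A) :
    perm R A n σ (PiTensorProduct.tprod R a) = PiTensorProduct.tprod R fun i => a (σ i) := by
  exact PiTensorProduct.lift.tprod _

/-- The `R`-algebra `(A^{⊗n})^{Sₙ}` of symmetric tensors. -/
def Fix : Subalgebra R (TPow R A n) where
  carrier := {x | ∀ σ : Equiv.Perm (Fin n), perm R A n σ x = x}
  mul_mem' hx hy σ := by rw [map_mul, hx σ, hy σ]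
  add_mem' hx hy σ := by rw [map_add, hx σ, hy σ]
  algebraMap_mem' r σ := (perm R A n σ).commutes r

variable {A}

/-- The diagonal tensor `a ⊗ a ⊗ ⋯ ⊗ a`. -/
def diag (a : A) : Fix R A n :=
  ⟨PiTensorProduct.tprod R fun _ => a, fun σ => perm_tprod R A n σ _⟩

/-- The conjugate `a^{(i)} = 1 ⊗ ⋯ ⊗ a ⊗ ⋯ ⊗ 1`, with `a` in the `i`-th place. -/
def conj (a : A) (i : Fin n) : TPow R A n :=
  PiTensorProduct.singleAlgHom (R := R) (A := fun _ : Fin n => A) i a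

theorem conj_def (a : A) (i : Fin n) :
    conj R n a i = PiTensorProduct.tprod R (Pi.mulSingle i a : Fin n → A) := rfl

theorem perm_conj (σ : Equiv.Perm (Fin n)) (a : A) (i : Fin n) :
    perm R A n σ (conj R n a i) = conj R n a (σ.symm i) := by
  rw [conj_def, conj_def, perm_tprod]
  congr 1
  funext j
  by_cases h : σ j = i
  · subst h
    simp
  · have h' : j ≠ σ.symm i := fun e => h (by simp [e])
    simp [h, h']

/-- `e_k(a)`: the `k`-th elementary symmetric polynomial evaluated at the `n` conjugates
`a^{(1)}, …, a^{(n)}`, as an element of `(A^{⊗n})^{Sₙ}`. -/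
def e (k : ℕ) (a : A) : Fix R A n :=
  ⟨MvPolynomial.aeval (conj R n a) (MvPolynomial.esymm (Fin n) R k), fun σ => by
    have h : (perm R A n σ).comp (MvPolynomial.aeval (conj R n a)) =
        (MvPolynomial.aeval (conj R n a)).comp (MvPolynomial.rename σ.symm) := by
      ext i
      simp [perm_conj]
    have h' := DFunLike.congr_fun h (MvPolynomial.esymm (Fin n) R k)
    simpa only [AlgHom.comp_apply, MvPolynomial.rename_esymm] using h'⟩

end TensorPower

section Norm

variable (R : Type u) [CommRing R] (A : Type v) [CommRing A] [Algebra R A] (n : ℕ)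

/-- `r` is the norm `N_{A/R}(a)` of `a`, where `A` is an `R`-algebra of rank `n`:
`(a a₁) ∧ ⋯ ∧ (a aₙ) = r (a₁ ∧ ⋯ ∧ aₙ)` in the `n`-th exterior power of the `R`-module `A`,
for all `a₁, …, aₙ` in `A`. -/
def IsNorm (a : A) (r : R) : Prop :=
  ∀ v : Fin n → A,
    exteriorPower.ιMulti R n (fun i => a * v i) = r • exteriorPower.ιMulti R n v

/-- `P` is the characteristic polynomial of `a`, i.e. the norm `N_{A[x]/R[x]}(x - a)`. -/
def IsCharpoly (a : A) (P : R[X]) : Prop :=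
  letI : Algebra R[X] A[X] := Polynomial.algebra R A
  IsNorm R[X] A[X] n (Polynomial.X - Polynomial.C a) P

/-- `s` is `s_k(a)`, the coefficient of `(-1)^k x^{n-k}` in the characteristic polynomial of `a`
(used for `k ≤ n`). -/
def IsS (k : ℕ) (a : A) (s : R) : Prop :=
  ∃ P : R[X], IsCharpoly R A n a P ∧ s = (-1) ^ k * P.coeff (n - k)

end Norm

section BaseChange

variable (R : Type u) [CommRing R] (A : Type v) [CommRing A] [Algebra R A] (n : ℕ)
  (R' : Type w) [CommRing R'] [Algebra R R']

/-- The canonical map `A^{⊗n} → (R' ⊗_R A)^{⊗n}` (the second power taken over `R'`),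
`a₁ ⊗ ⋯ ⊗ aₙ ↦ (1 ⊗ a₁) ⊗ ⋯ ⊗ (1 ⊗ aₙ)`. -/
def bcTPow : TPow R A n →ₐ[R] TPow R' (R' ⊗[R] A) n :=
  PiTensorProduct.liftAlgHom
    (((PiTensorProduct.tprod R' (s := fun _ : Fin n => R' ⊗[R] A)).restrictScalars R).compLinearMap
      fun _ => (Algebra.TensorProduct.includeRight : A →ₐ[R] R' ⊗[R] A).toLinearMap)
    rfl (fun x y => by
      simp only [MultilinearMap.compLinearMap_apply, MultilinearMap.coe_restrictScalars,
        PiTensorProduct.tprod_mul_tprod]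
      congr 1
      funext i
      simp)

@[simp] theorem bcTPow_tprod (a : Fin n → A) :
    bcTPow R A n R' (PiTensorProduct.tprod R a) =
      PiTensorProduct.tprod R' fun i => (1 : R') ⊗ₜ[R] a i := by
  simp [bcTPow]

theorem perm_bcTPow (σ : Equiv.Perm (Fin n)) (x : TPow R A n) :
    perm R' (R' ⊗[R] A) n σ (bcTPow R A n R' x) = bcTPow R A n R' (perm R A n σ x) := by
  induction x using PiTensorProduct.induction_on with
  | smul_tprod r a =>
    rw [map_smul (bcTPow R A n R'), map_smul (perm R A n σ), map_smul (bcTPow R A n R'),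
      ← algebraMap_smul R' r, map_smul, perm_tprod, bcTPow_tprod, bcTPow_tprod, perm_tprod,
      algebraMap_smul]
  | add x y hx hy => rw [map_add, map_add, map_add, map_add, hx, hy]

/-- The canonical map `(A^{⊗n})^{Sₙ} → ((R' ⊗_R A)^{⊗n})^{Sₙ}` on symmetric tensors. -/
def bcFix (x : Fix R A n) : Fix R' (R' ⊗[R] A) n :=
  ⟨bcTPow R A n R' x, fun σ => by rw [perm_bcTPow, x.2 σ]⟩

end BaseChange

/-- `φ : (A^{⊗n})^{Sₙ} → R` is the Ferrand homomorphism of the rank-`n` algebra `A`: the algebra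
homomorphism that corresponds to the norm as a polynomial law. That is, over every `R`-algebra `R'`
it has a base change `φ'`, an `R'`-algebra homomorphism for which the base change square commutes
and which sends each `a ⊗ ⋯ ⊗ a`, for `a` in `R' ⊗_R A`, to the norm of `a`. -/
def IsFerrand {R : Type u} [CommRing R] {A : Type v} [CommRing A] [Algebra R A] {n : ℕ}
    (φ : Fix R A n →ₐ[R] R) : Prop :=
  ∀ (R' : Type u) [CommRing R'] [Algebra R R'],
    ∃ φ' : Fix R' (R' ⊗[R] A) n →ₐ[R'] R',
      (∀ x : Fix R A n, φ' (bcFix R A n R' x) = algebraMap R R' (φ x)) ∧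
      ∀ a : R' ⊗[R] A, IsNorm R' (R' ⊗[R] A) n a (φ' (diag R' n a))

end Ferrand

end

/-!
Let `π : A^{⊗n} → ⋀ⁿ A` be the canonical projection. Multiplication by a symmetric tensor preserves
the kernel of `π` (`toExterior_mul_tprod_eq_zero`), so the symmetric tensors act on the top exterior
power, an invertible module, and hence act by scalars: `π (x y) = φ(x) π(y)`. The resulting map `φ`
is an algebra homomorphism (`exists_normHom`). It sends `a ⊗ ⋯ ⊗ a` to the norm of `a` by the very
definition of the norm, and it commutes with base change (`normHom_bcFix`), so it is a Ferrand
homomorphism.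

Over `R[X]`, the diagonal tensor of `X - a` is `∏ᵢ (X - a⁽ⁱ⁾) = ∑ₖ (-1)ᵏ e_k(a) X^{n-k}`. Every
Ferrand homomorphism therefore sends `e_k(a)` to `s_k(a)` (`IsFerrand.isS`), and the existence of
characteristic polynomials comes out as well; they are unique because scalars act faithfully on the
top exterior power (`eq_of_smul_ιMulti_eq`).

All uniqueness of homomorphisms follows from the fact that the symmetric tensors are generated as
an algebra by the `e_k(a)` (`adjoin_e_eq_top`). They are spanned by orbit sums of
`b_{j₁} ⊗ ⋯ ⊗ b_{jₙ}`, and each orbit sum is a coefficient of `F ⊗ ⋯ ⊗ F` for a series `F` in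
`A⟦t⟧` that has constant term `1`, up to a power of `t`. Such a series is an infinite product of
factors `1 + c t^m`, and the coefficients of the `n`-th tensor power of `1 + c t^m` are the `e_k(c)`.

Local freeness is used in a form without localizations: the unit ideal is generated by scalars `s`
with linear maps `A → Rⁿ → A` and `Rⁿ → A → Rⁿ` composing to `s` (`IsFreeUpTo`). Identities and
existence statements are proved up to powers of such `s`.
-/

noncomputable section

namespace Ferrand

/-! ### Modules that are free up to multiplication by a scalar -/

section FreeUpTo

/-- `M` is free of rank `n` up to the scalar `s`: there are linear maps `M → Rⁿ` and `Rⁿ → M` whose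
two composites are multiplication by `s`. This is a denominator-free form of `M_s` being free of
rank `n`; it is inherited by base change, and a multilinear identity that holds for `Rⁿ` holds for
`M` after multiplication by a power of `s`. -/
def IsFreeUpTo (R : Type*) [CommRing R] (M : Type*) [AddCommGroup M] [Module R M] (n : ℕ)
    (s : R) : Prop :=
  ∃ (f : M →ₗ[R] Fin n → R) (g : (Fin n → R) →ₗ[R] M),
    g ∘ₗ f = s • LinearMap.id ∧ f ∘ₗ g = s • LinearMap.id

/-- Clearing denominators in an isomorphism `M_r ≃ R_rⁿ` and in its inverse, both of which lift
because `M` and `Rⁿ` are finitely presented, leaves a power of `r`. -/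
theorem exists_isFreeUpTo_pow {R : Type*} [CommRing R] {M : Type*} [AddCommGroup M] [Module R M]
    [Module.FinitePresentation R M] {n : ℕ} (r : R)
    (b : Module.Basis (Fin n) (Localization.Away r) (LocalizedModule (Submonoid.powers r) M)) :
    ∃ k : ℕ, IsFreeUpTo R M n (r ^ k) := by
  let S := Submonoid.powers r
  let p : M →ₗ[R] LocalizedModule S M := LocalizedModule.mkLinearMap S M
  let q : (Fin n → R) →ₗ[R] (Fin n → Localization.Away r) :=
    .pi fun i ↦ Algebra.linearMap R (Localization.Away r) ∘ₗ .proj i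
  have : IsLocalizedModule S (Algebra.linearMap R (Localization.Away r)) := inferInstance
  have : IsLocalizedModule S q := inferInstance
  let ε : LocalizedModule S M ≃ₗ[R] (Fin n → Localization.Away r) := b.equivFun.restrictScalars R
  obtain ⟨f, s₁, hf⟩ := Module.FinitePresentation.exists_lift_of_isLocalizedModule S q
    (ε.toLinearMap ∘ₗ p)
  obtain ⟨g, s₂, hg⟩ := Module.FinitePresentation.exists_lift_of_isLocalizedModule S p
    (ε.symm.toLinearMap ∘ₗ q)
  have hf' (x : M) : q (f x) = s₁ • ε (p x) := LinearMap.congr_fun hf x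
  have hg' (x : Fin n → R) : p (g x) = s₂ • ε.symm (q x) := LinearMap.congr_fun hg x
  obtain ⟨s₃, h₃⟩ := Module.Finite.exists_smul_of_comp_eq_of_isLocalizedModule S p
    (g ∘ₗ f) ((s₂ * s₁) • LinearMap.id) (by
      ext x
      simp only [LinearMap.comp_apply, hg', hf', LinearMap.smul_apply, LinearMap.id_apply,
        Submonoid.smul_def, map_smul, LinearEquiv.symm_apply_apply, mul_smul])
  obtain ⟨s₄, h₄⟩ := Module.Finite.exists_smul_of_comp_eq_of_isLocalizedModule S q
    (f ∘ₗ g) ((s₁ * s₂) • LinearMap.id) (by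
      refine LinearMap.ext fun x ↦ ?_
      simp only [LinearMap.comp_apply, hg', hf', LinearMap.smul_apply, LinearMap.id_apply,
        Submonoid.smul_def, map_smul, LinearEquiv.apply_symm_apply, mul_smul])
  obtain ⟨k, hk⟩ := (s₃ * s₄ * (s₁ * s₂)).2
  refine ⟨k, ((s₃ * s₄ : S) : R) • f, g, ?_, ?_⟩
  · change r ^ k = _ at hk
    ext x
    have := congr((s₄ : R) • $(LinearMap.congr_fun h₃ x))
    simp only [Submonoid.smul_def, LinearMap.smul_apply, LinearMap.comp_apply, LinearMap.id_apply,
      Submonoid.coe_mul] at this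
    simp only [hk, LinearMap.smul_apply, LinearMap.comp_apply, LinearMap.id_apply, map_smul,
      Submonoid.coe_mul]
    rw [mul_comm (s₃ : R), mul_smul, this]
    simp only [← mul_smul]
    congr 1
    ring
  · change r ^ k = _ at hk
    refine LinearMap.ext fun x ↦ ?_
    have := congr((s₃ : R) • $(LinearMap.congr_fun h₄ x))
    simp only [Submonoid.smul_def, LinearMap.smul_apply, LinearMap.comp_apply, LinearMap.id_apply,
      Submonoid.coe_mul] at this
    simp only [hk, LinearMap.smul_apply, LinearMap.comp_apply, LinearMap.id_apply,
      Submonoid.coe_mul]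
    rw [mul_smul, this]
    simp only [← mul_smul]
    congr 1
    ring

theorem LocallyFreeOfRank.span_isFreeUpTo {R : Type u} [CommRing R] {M : Type v} [AddCommGroup M]
    [Module R M] {n : ℕ} (h : LocallyFreeOfRank R M n) :
    Ideal.span {s : R | IsFreeUpTo R M n s} = ⊤ := by
  have : Module.FinitePresentation R M := .of_localizationSpan _ h fun ⟨r, ⟨b⟩⟩ ↦
    have := Module.Free.of_basis b
    have := Module.Finite.of_basis b
    Module.finitePresentation_of_projective _ _
  rw [← Ideal.radical_eq_top, eq_top_iff, ← h, Ideal.span_le]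
  rintro r ⟨b⟩
  obtain ⟨k, hk⟩ := exists_isFreeUpTo_pow r b
  exact ⟨k, Ideal.subset_span hk⟩

theorem IsFreeUpTo.baseChange {R : Type*} [CommRing R] {M : Type*} [AddCommGroup M] [Module R M]
    {n : ℕ} {s : R} (h : IsFreeUpTo R M n s) (R' : Type*) [CommRing R'] [Algebra R R'] :
    IsFreeUpTo R' (R' ⊗[R] M) n (algebraMap R R' s) := by
  obtain ⟨f, g, hgf, hfg⟩ := h
  let ε : R' ⊗[R] (Fin n → R) ≃ₗ[R'] (Fin n → R') := TensorProduct.piScalarRight R R' R' (Fin n)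
  refine ⟨ε.toLinearMap ∘ₗ f.baseChange R', g.baseChange R' ∘ₗ ε.symm.toLinearMap, ?_, ?_⟩
  · ext x
    have := LinearMap.congr_fun hgf x
    simp only [LinearMap.comp_apply] at this
    simp [this]
  · refine LinearMap.ext fun x ↦ ?_
    obtain ⟨y, rfl⟩ := ε.surjective x
    have : f.baseChange R' ∘ₗ g.baseChange R' = algebraMap R R' s • LinearMap.id := by
      rw [← LinearMap.baseChange_comp, hfg]
      ext
      simp
    change ε (f.baseChange R' (g.baseChange R' (ε.symm (ε y)))) = _
    rw [ε.symm_apply_apply]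
    exact congr(ε $(LinearMap.congr_fun this y)).trans (map_smul ε _ _)

theorem span_isFreeUpTo_baseChange {R : Type*} [CommRing R] {M : Type*} [AddCommGroup M]
    [Module R M] {n : ℕ} (h : Ideal.span {s : R | IsFreeUpTo R M n s} = ⊤)
    (R' : Type*) [CommRing R'] [Algebra R R'] :
    Ideal.span {s : R' | IsFreeUpTo R' (R' ⊗[R] M) n s} = ⊤ := by
  have := congr(Ideal.map (algebraMap R R') $h)
  rw [Ideal.map_span, Ideal.map_top] at this
  rw [eq_top_iff, ← this]
  refine Ideal.span_mono ?_
  rintro _ ⟨s, hs, rfl⟩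
  exact hs.baseChange R'

end FreeUpTo

/-! ### Coordinates on tensor powers -/

section Coordinates

theorem apply_eq_sum_smul_single {R : Type*} [CommRing R] {M : Type*} [AddCommGroup M]
    [Module R M] {m : ℕ} (g : (Fin m → R) →ₗ[R] M) (x : Fin m → R) :
    g x = ∑ j, x j • g (Pi.single j 1) := by
  rw [LinearMap.pi_apply_eq_sum_univ g]
  refine Finset.sum_congr rfl fun j _ ↦ ?_
  congr 2
  ext l
  simp [Pi.single_apply, eq_comm]

variable {R : Type*} [CommRing R] {A : Type*} [CommRing A] [Algebra R A] {n m : ℕ}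

/-- The coordinate function on the `n`-th tensor power with multi-index `c`, with respect to a linear
map `f : A → Rᵐ`: `a₁ ⊗ ⋯ ⊗ aₙ ↦ ∏ᵢ f(aᵢ)_{c(i)}`. -/
def tensorCoord (f : A →ₗ[R] Fin m → R) (c : Fin n → Fin m) : TPow R A n →ₗ[R] R :=
  PiTensorProduct.lift
    ((MultilinearMap.mkPiAlgebra R (Fin n) R).compLinearMap fun i ↦ LinearMap.proj (c i) ∘ₗ f)

@[simp] theorem tensorCoord_tprod (f : A →ₗ[R] Fin m → R) (c : Fin n → Fin m) (a : Fin n → A) :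
    tensorCoord f c (PiTensorProduct.tprod R a) = ∏ i, f (a i) (c i) := by
  simp [tensorCoord]

theorem tensorCoord_perm (f : A →ₗ[R] Fin m → R) (c : Fin n → Fin m) (σ : Equiv.Perm (Fin n))
    (y : TPow R A n) : tensorCoord f (c ∘ σ) (perm R A n σ y) = tensorCoord f c y := by
  induction y using PiTensorProduct.induction_on with
  | smul_tprod r a =>
    simp only [map_smul, perm_tprod, tensorCoord_tprod, Function.comp_apply]
    rw [Equiv.prod_comp σ fun i ↦ f (a i) (c i)]
  | add x y hx hy => simp only [map_add, hx, hy]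

/-- The coordinates of a symmetric tensor are constant on orbits of multi-indices. -/
theorem tensorCoord_comp_perm (f : A →ₗ[R] Fin m → R) (x : Fix R A n) (c : Fin n → Fin m)
    (σ : Equiv.Perm (Fin n)) : tensorCoord f (c ∘ σ) (x : TPow R A n) = tensorCoord f c x := by
  conv_lhs => rw [← x.2 σ]
  exact tensorCoord_perm f c σ _

/-- If `g ∘ f = s`, a tensor is recovered from its coordinates up to the factor `sⁿ`. -/
theorem pow_smul_eq_sum_tensorCoord {f : A →ₗ[R] Fin m → R} {g : (Fin m → R) →ₗ[R] A} {s : R}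
    (h : g ∘ₗ f = s • LinearMap.id) (y : TPow R A n) :
    s ^ n • y = ∑ c : Fin n → Fin m,
      tensorCoord f c y • PiTensorProduct.tprod R fun i ↦ g (Pi.single (c i) 1) := by
  induction y using PiTensorProduct.induction_on with
  | smul_tprod r a =>
    have key (x : A) : s • x = ∑ j, f x j • g (Pi.single j 1) := by
      rw [← apply_eq_sum_smul_single]
      exact (LinearMap.congr_fun h x).symm
    have : s ^ n • PiTensorProduct.tprod R a = PiTensorProduct.tprod R fun i ↦ s • a i := by
      rw [MultilinearMap.map_smul_univ]
      simp
    rw [smul_comm, this]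
    simp only [key, MultilinearMap.map_sum, MultilinearMap.map_smul_univ, map_smul,
      tensorCoord_tprod, Finset.smul_sum, smul_assoc]
  | add x y hx hy => simp only [map_add, smul_add, hx, hy, add_smul, Finset.sum_add_distrib]

end Coordinates

/-! ### Generation of symmetric tensors by elementary symmetric ones -/

section Generation

variable (R : Type*) [CommRing R] (A : Type*) [CommRing A] [Algebra R A] (n : ℕ)

/-- The subalgebra of `A^{⊗n}` generated by all `e_k(a)`, inside the whole tensor power and not
inside `Fix R A n`, so that products of conjugates can be formed freely. -/
def esymmSubalgebra : Subalgebra R (TPow R A n) :=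
  Algebra.adjoin R {x | ∃ (k : ℕ) (a : A), (e R n k a : TPow R A n) = x}

theorem coe_e {A : Type*} [CommRing A] [Algebra R A] (k : ℕ) (a : A) :
    (e R n k a : TPow R A n) =
      ∑ t ∈ Finset.powersetCard k (Finset.univ : Finset (Fin n)), ∏ i ∈ t, conj R n a i := by
  simp [e, MvPolynomial.esymm]

theorem prod_conj {A : Type*} [CommRing A] [Algebra R A] (a : Fin n → A) :
    ∏ i, conj R n (a i) i = PiTensorProduct.tprod R a := by
  simp only [conj_def, ← PiTensorProduct.tprod_prod]
  congr 1
  exact Finset.univ_prod_mulSingle a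

variable {A}

/-- The multiplicative map `A⟦t⟧ → A^{⊗n}⟦t⟧` that sends `f` to the product of its conjugates
`f⁽ⁱ⁾`, the image of `f ⊗ ⋯ ⊗ f`. -/
def tensorSeries (f : PowerSeries A) : PowerSeries (TPow R A n) :=
  ∏ i : Fin n, PowerSeries.map (PiTensorProduct.singleAlgHom (R := R) i).toRingHom f

theorem map_conj_C (a : A) (i : Fin n) :
    PowerSeries.map (PiTensorProduct.singleAlgHom (R := R) i).toRingHom (PowerSeries.C a) =
      PowerSeries.C (conj R n a i) :=
  PowerSeries.map_C _ _

theorem tensorSeries_mul (f g : PowerSeries A) :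
    tensorSeries R n (f * g) = tensorSeries R n f * tensorSeries R n g := by
  simp [tensorSeries, Finset.prod_mul_distrib]

theorem tensorSeries_one_add_C_mul_X_pow (a : A) (m : ℕ) :
    tensorSeries R n (1 + PowerSeries.C a * PowerSeries.X ^ m) =
      ∑ k ∈ Finset.range (n + 1),
        PowerSeries.C (e R n k a : TPow R A n) * PowerSeries.X ^ (m * k) := by
  simp only [tensorSeries, map_add, map_one, map_mul, map_pow, map_conj_C, PowerSeries.map_X]
  rw [Finset.prod_one_add, Finset.sum_powerset]
  simp only [Finset.card_univ, Fintype.card_fin]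
  refine Finset.sum_congr rfl fun k _ ↦ ?_
  rw [coe_e, map_sum, Finset.sum_mul]
  refine Finset.sum_congr rfl fun t ht ↦ ?_
  rw [Finset.prod_mul_distrib, Finset.prod_const, (Finset.mem_powersetCard.mp ht).2, map_prod,
    pow_mul]

theorem X_pow_dvd_tensorSeries_sub_one {m : ℕ} {f : PowerSeries A}
    (hf : PowerSeries.X ^ m ∣ f - 1) : PowerSeries.X ^ m ∣ tensorSeries R n f - 1 := by
  refine Finset.prod_induction _ (fun g : PowerSeries (TPow R A n) ↦ PowerSeries.X ^ m ∣ g - 1)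
    (fun g h hg hh ↦ ?_) (by simp) fun i _ ↦ ?_
  · have : g * h - 1 = g * (h - 1) + (g - 1) := by ring
    rw [this]
    exact dvd_add (hh.mul_left _) hg
  · have := map_dvd (PowerSeries.map
      (PiTensorProduct.singleAlgHom (R := R) (A := fun _ : Fin n ↦ A) i).toRingHom) hf
    simpa using this

/-- A series `f ≡ 1 mod t^{m+1}` with coefficient `c` at `t^{m+1}` is the product of `1 + c t^{m+1}`
and a series that is `1` modulo `t^{m+2}`. The coefficients of the conjugate product of the first
factor are the `e_k(c)`, and for the second factor the induction, on `k`, ends as soon as `m` reaches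
the degree `d` of interest. -/
theorem coeff_tensorSeries_mem_of_X_pow_dvd (d k : ℕ) : ∀ (m : ℕ) (f : PowerSeries A),
    d < m + 1 + k → PowerSeries.X ^ (m + 1) ∣ f - 1 → ∀ j ≤ d,
      PowerSeries.coeff j (tensorSeries R n f) ∈ esymmSubalgebra R A n := by
  induction k with
  | zero =>
    intro m f hm hf j hj
    have := PowerSeries.X_pow_dvd_iff.mp (X_pow_dvd_tensorSeries_sub_one R n hf) j (by omega)
    rw [map_sub, sub_eq_zero] at this
    rw [this, PowerSeries.coeff_one]
    split_ifs
    exacts [one_mem _, zero_mem _]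
  | succ k ih =>
    intro m f hm hf j hj
    set h : PowerSeries A :=
      1 + PowerSeries.C (PowerSeries.coeff (m + 1) f) * PowerSeries.X ^ (m + 1) with hh
    have hu : IsUnit h := by
      rw [PowerSeries.isUnit_iff_constantCoeff]
      simp [hh]
    obtain ⟨h', hh'⟩ := hu.exists_right_inv
    have hfac : f = h * (f * h') := by rw [mul_left_comm, hh', mul_one]
    have hdvd : PowerSeries.X ^ (m + 1 + 1) ∣ f * h' - 1 := by
      have : f * h' - 1 = (f - h) * h' := by rw [sub_mul, hh']
      rw [this]
      refine Dvd.dvd.mul_right (PowerSeries.X_pow_dvd_iff.mpr fun l hl ↦ ?_) _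
      rcases Nat.lt_succ_iff_lt_or_eq.mp hl with hl | rfl
      · have := PowerSeries.X_pow_dvd_iff.mp hf l hl
        rw [map_sub] at this
        rw [hh, ← sub_sub, map_sub, map_sub, this, PowerSeries.coeff_C_mul_X_pow, if_neg hl.ne,
          sub_zero]
      · rw [hh, ← sub_sub, map_sub, map_sub, PowerSeries.coeff_C_mul_X_pow, if_pos rfl,
          PowerSeries.coeff_one, if_neg (by omega)]
        simp
    rw [hfac, tensorSeries_mul, PowerSeries.coeff_mul]
    refine sum_mem fun p hp ↦ ?_
    have hp' := Finset.HasAntidiagonal.mem_antidiagonal.mp hp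
    refine mul_mem ?_ (ih (m + 1) _ (by omega) hdvd p.2 (by omega))
    rw [hh, tensorSeries_one_add_C_mul_X_pow, map_sum]
    refine sum_mem fun l _ ↦ ?_
    rw [PowerSeries.coeff_C_mul_X_pow]
    split_ifs
    exacts [Algebra.subset_adjoin ⟨_, _, rfl⟩, zero_mem _]

theorem coeff_tensorSeries_mem {f : PowerSeries A} (hf : PowerSeries.constantCoeff f = 1) (d : ℕ) :
    PowerSeries.coeff d (tensorSeries R n f) ∈ esymmSubalgebra R A n := by
  refine coeff_tensorSeries_mem_of_X_pow_dvd R n d d 0 f (by omega) ?_ d le_rfl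
  rw [zero_add, pow_one, PowerSeries.X_dvd_iff]
  simp [hf]

/-- A word `p` of length `n` is determined up to rearrangement by `∑ᵢ (n+2)^{p(i)}`: the digits of
this number in base `n + 2` are the numbers of occurrences of the letters. -/
theorem exists_perm_of_sum_pow_eq {n m : ℕ} (p q : Fin n → Fin m)
    (h : ∑ i, (n + 2) ^ (p i : ℕ) = ∑ i, (n + 2) ^ (q i : ℕ)) :
    ∃ σ : Equiv.Perm (Fin n), p = q ∘ σ := by
  have key (p : Fin n → Fin m) : ∑ i, (n + 2) ^ (p i : ℕ) =
      Behrend.map (n + 2) fun j ↦ (Finset.univ.filter fun i ↦ p i = j).card := by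
    rw [← Finset.sum_fiberwise Finset.univ p]
    refine Finset.sum_congr rfl fun j _ ↦ ?_
    rw [Finset.sum_congr rfl fun i hi ↦ by rw [(Finset.mem_filter.mp hi).2], Finset.sum_const,
      smul_eq_mul]
  have hlt (p : Fin n → Fin m) (j : Fin m) :
      (Finset.univ.filter fun i ↦ p i = j).card < n + 2 :=
    Nat.lt_add_right 1 (Nat.lt_succ_of_le ((Finset.card_le_univ _).trans_eq (Fintype.card_fin n)))
  rw [key, key] at h
  have hcard := congr_fun (Behrend.map_injOn (hlt p) (hlt q) h)
  have hfib (j : Fin m) : Nonempty ({i // p i = j} ≃ {i // q i = j}) :=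
    ⟨Fintype.equivOfCardEq (by simpa only [Fintype.card_subtype] using hcard j)⟩
  exact ⟨Equiv.ofFiberEquiv fun j ↦ (hfib j).some, funext fun i ↦ (Equiv.ofFiberEquiv_map _ i).symm⟩

/-- With `b₀ = 1`, the sum of all `b_{p(1)} ⊗ ⋯ ⊗ b_{p(n)}` over the words `p` of a given weight is a
coefficient of the product of conjugates of `∑ⱼ bⱼ t^{(n+2)^j}`. -/
theorem sum_tprod_mem {m : ℕ} (b : Fin (m + 1) → A) (hb : b 0 = 1) (d : ℕ) :
    ∑ p : Fin n → Fin (m + 1) with ∑ i, (n + 2) ^ (p i : ℕ) = d,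
      PiTensorProduct.tprod R (fun i ↦ b (p i)) ∈ esymmSubalgebra R A n := by
  let f : PowerSeries A := ∑ j, PowerSeries.C (b j) * PowerSeries.X ^ ((n + 2) ^ (j : ℕ) - 1)
  have hf : PowerSeries.constantCoeff f = 1 := by
    have h (j : ℕ) : (n + 2) ^ (j + 1) - 1 ≠ 0 :=
      Nat.sub_ne_zero_of_lt (Nat.one_lt_pow (by omega) (by omega))
    simp only [f, Fin.sum_univ_succ, map_add, map_sum, map_mul, map_pow]
    simp [hb, h]
  -- The exponents in `f` are lowered by one to make its constant coefficient `b 0 = 1`.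
  have hXf : PowerSeries.X * f = ∑ j, PowerSeries.C (b j) * PowerSeries.X ^ (n + 2) ^ (j : ℕ) := by
    simp only [f, Finset.mul_sum]
    refine Finset.sum_congr rfl fun j _ ↦ ?_
    rw [mul_left_comm, ← pow_succ', Nat.sub_add_cancel (Nat.pos_of_ne_zero (by positivity))]
  have hX : tensorSeries R n (PowerSeries.X : PowerSeries A) = PowerSeries.X ^ n := by
    simp [tensorSeries]
  have hexp : tensorSeries R n (PowerSeries.X * f) = ∑ p : Fin n → Fin (m + 1),
      PowerSeries.C (PiTensorProduct.tprod R fun i ↦ b (p i)) *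
        PowerSeries.X ^ ∑ i, (n + 2) ^ (p i : ℕ) := by
    rw [hXf, tensorSeries]
    simp only [map_sum, map_mul, map_pow, map_conj_C, PowerSeries.map_X]
    rw [Finset.prod_univ_sum, Fintype.piFinset_univ]
    refine Finset.sum_congr rfl fun p _ ↦ ?_
    rw [Finset.prod_mul_distrib, ← map_prod, prod_conj, Finset.prod_pow_eq_pow_sum]
  have hcoeff := congr(PowerSeries.coeff d $hexp)
  simp only [map_sum, PowerSeries.coeff_C_mul_X_pow] at hcoeff
  rw [Finset.sum_filter]
  simp only [eq_comm (b := d)]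
  rw [← hcoeff, tensorSeries_mul, hX, PowerSeries.coeff_X_pow_mul']
  split_ifs
  exacts [coeff_tensorSeries_mem R n hf _, zero_mem _]

/-- A combination of the tensors `b_{c(1)} ⊗ ⋯ ⊗ b_{c(n)}` whose coefficients are constant on orbits
is a combination of the orbit sums, which are the sums over the words of a given weight. -/
theorem sum_smul_tprod_mem {m : ℕ} (b : Fin (m + 1) → A) (hb : b 0 = 1)
    (x : (Fin n → Fin (m + 1)) → R)
    (hx : ∀ (c : Fin n → Fin (m + 1)) (σ : Equiv.Perm (Fin n)), x (c ∘ σ) = x c) :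
    ∑ c, x c • PiTensorProduct.tprod R (fun i ↦ b (c i)) ∈ esymmSubalgebra R A n := by
  let W (c : Fin n → Fin (m + 1)) : ℕ := ∑ i, (n + 2) ^ (c i : ℕ)
  rw [← Finset.sum_fiberwise_of_maps_to (t := Finset.univ.image W) (g := W)
    fun c _ ↦ Finset.mem_image_of_mem _ (Finset.mem_univ c)]
  refine sum_mem fun d hd ↦ ?_
  obtain ⟨c₀, -, rfl⟩ := Finset.mem_image.mp hd
  have hc (c) (h : c ∈ Finset.univ.filter fun c ↦ W c = W c₀) : x c = x c₀ := by
    obtain ⟨σ, rfl⟩ := exists_perm_of_sum_pow_eq c c₀ (Finset.mem_filter.mp h).2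
    exact hx c₀ σ
  rw [Finset.sum_congr rfl fun c h ↦ by rw [hc c h], ← Finset.smul_sum]
  exact Subalgebra.smul_mem _ (sum_tprod_mem R n b hb _) _

/-- For `A` locally free of any rank, the algebra of symmetric tensors is generated by the `e_k(a)`. -/
theorem adjoin_e_eq_top {m : ℕ} (hA : Ideal.span {s : R | IsFreeUpTo R A m s} = ⊤) :
    Algebra.adjoin R {x | ∃ (k : ℕ) (a : A), e R n k a = x} = ⊤ := by
  have himage : (Algebra.adjoin R {x | ∃ (k : ℕ) (a : A), e R n k a = x}).map (Fix R A n).val =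
      esymmSubalgebra R A n := by
    rw [AlgHom.map_adjoin, esymmSubalgebra]
    congr 1
    ext x
    simp
  refine eq_top_iff.mpr fun x _ ↦ ?_
  suffices h : (x : TPow R A n) ∈ esymmSubalgebra R A n by
    rw [← himage] at h
    obtain ⟨y, hy, hyx⟩ := h
    rwa [← Subtype.ext hyx]
  refine Submodule.mem_of_span_eq_top_of_smul_pow_mem (esymmSubalgebra R A n).toSubmodule _ hA _ ?_
  rintro ⟨s, f, g, hgf, -⟩
  refine ⟨n, ?_⟩
  -- The unit is added to the generators, with coordinate zero.
  let f' : A →ₗ[R] Fin (m + 1) → R := .pi (Fin.cons 0 fun j ↦ .proj j ∘ₗ f)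
  let b : Fin (m + 1) → A := Fin.cons 1 fun j ↦ g (Pi.single j 1)
  let g' : (Fin (m + 1) → R) →ₗ[R] A := Fintype.linearCombination R b
  have hgf' : g' ∘ₗ f' = s • LinearMap.id := by
    rw [← hgf]
    ext x
    rw [LinearMap.comp_apply, LinearMap.comp_apply, apply_eq_sum_smul_single g]
    simp only [g', f', b, Fintype.linearCombination_apply, Fin.sum_univ_succ, LinearMap.pi_apply,
      Fin.cons_zero, Fin.cons_succ, LinearMap.zero_apply, zero_smul, zero_add]
    rfl
  have hg' (j) : g' (Pi.single j 1) = b j := by simp [g']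
  rw [Subalgebra.mem_toSubmodule, pow_smul_eq_sum_tensorCoord hgf']
  simp only [hg']
  exact sum_smul_tprod_mem R n b rfl _ (tensorCoord_comp_perm f' x)

end Generation

/-! ### The action of symmetric tensors on the top exterior power -/

section NormHom

variable (R : Type*) [CommRing R] (A : Type*) [CommRing A] [Algebra R A] (n : ℕ)

/-- The canonical projection `A^{⊗n} → ⋀ⁿ A`. -/
def toExterior : TPow R A n →ₗ[R] ⋀[R]^n A :=
  PiTensorProduct.lift (exteriorPower.ιMulti R n).toMultilinearMap

@[simp] theorem toExterior_tprod (a : Fin n → A) :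
    toExterior R A n (PiTensorProduct.tprod R a) = exteriorPower.ιMulti R n a :=
  PiTensorProduct.lift.tprod _

variable {R A n}

/-- Multiplication by a symmetric tensor preserves the kernel of `A^{⊗n} → ⋀ⁿ A`. In coordinates, if
`aᵢ = aⱼ`, the terms of `x · (a₁ ⊗ ⋯ ⊗ aₙ)` with multi-indices exchanged by the transposition
`(i j)` cancel in the exterior power, and those fixed by it vanish there. -/
theorem toExterior_mul_tprod_eq_zero {m : ℕ}
    (hA : Ideal.span {s : R | IsFreeUpTo R A m s} = ⊤) (x : Fix R A n) {a : Fin n → A}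
    {i j : Fin n} (ha : a i = a j) (hij : i ≠ j) :
    toExterior R A n (x * PiTensorProduct.tprod R a) = 0 := by
  rw [← Submodule.mem_bot R]
  refine Submodule.mem_of_span_eq_top_of_smul_pow_mem ⊥ _ hA _ ?_
  rintro ⟨s, f, g, hgf, -⟩
  refine ⟨n, (Submodule.mem_bot R).mpr ?_⟩
  have ha' (l : Fin n) : a (Equiv.swap i j l) = a l := by
    by_cases h₁ : l = i
    · simp [h₁, ha]
    by_cases h₂ : l = j
    · simp [h₂, ha]
    rw [Equiv.swap_apply_of_ne_of_ne h₁ h₂]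
  rw [← map_smul, ← smul_mul_assoc, pow_smul_eq_sum_tensorCoord hgf, Finset.sum_mul, map_sum]
  simp only [smul_mul_assoc, PiTensorProduct.tprod_mul_tprod, map_smul, toExterior_tprod]
  refine Finset.sum_involution (fun c _ ↦ c ∘ Equiv.swap i j) (fun c _ ↦ ?_) (fun c _ hc h ↦ hc ?_)
    (fun _ _ ↦ Finset.mem_univ _) (fun c _ ↦ ?_)
  · rw [tensorCoord_comp_perm, ← smul_add]
    have h := AlternatingMap.map_add_swap (exteriorPower.ιMulti R n)
      (fun l ↦ g (Pi.single (c l) 1) * a l) hij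
    simp only [Function.comp_def, ha'] at h
    exact (congrArg _ h).trans (smul_zero _)
  · rw [AlternatingMap.map_eq_zero_of_eq _ _ ?_ hij, smul_zero]
    have := congr_fun h i
    simp only [Function.comp_apply, Equiv.swap_apply_left] at this
    simp [ha, this]
  · ext l
    simp

/-- The alternating map `(a₁, …, aₙ) ↦ x · (a₁ ∧ ⋯ ∧ aₙ)` given by a symmetric tensor `x`. -/
def mulAlternating {m : ℕ} (hA : Ideal.span {s : R | IsFreeUpTo R A m s} = ⊤) (x : Fix R A n) :
    A [⋀^Fin n]→ₗ[R] ⋀[R]^n A where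
  __ := (toExterior R A n ∘ₗ LinearMap.mulLeft R (x : TPow R A n)).compMultilinearMap
    (PiTensorProduct.tprod R)
  map_eq_zero_of_eq' _ _ _ ha hij := toExterior_mul_tprod_eq_zero hA x ha hij

theorem mulAlternating_apply {m : ℕ} (hA : Ideal.span {s : R | IsFreeUpTo R A m s} = ⊤)
    (x : Fix R A n) (a : Fin n → A) :
    mulAlternating hA x a = toExterior R A n (x * PiTensorProduct.tprod R a) := rfl

/-- Up to the factor `sⁿ`, an alternating map in `n` variables on a module that is free of rank `n`
up to `s` is a multiple of the determinant. -/
theorem pow_smul_alternating {M N : Type*} [AddCommGroup M] [Module R M] [AddCommGroup N]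
    [Module R N] {f : M →ₗ[R] Fin n → R}
    {g : (Fin n → R) →ₗ[R] M} {s : R} (h : g ∘ₗ f = s • LinearMap.id) (F : M [⋀^Fin n]→ₗ[R] N)
    (a : Fin n → M) :
    s ^ n • F a = (Pi.basisFun R (Fin n)).det (fun i ↦ f (a i)) •
      F fun i ↦ g (Pi.single i 1) := by
  have h₁ : s ^ n • F a = F fun i ↦ s • a i := by
    rw [AlternatingMap.map_smul_univ]
    simp
  have h₂ : F.compLinearMap g =
      (LinearMap.toSpanSingleton R N (F fun i ↦ g (Pi.single i 1))).compAlternatingMap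
        (Pi.basisFun R (Fin n)).det := by
    refine Module.Basis.ext_alternating (Pi.basisFun R (Fin n)) fun c hc ↦ ?_
    let σ : Equiv.Perm (Fin n) := Equiv.ofBijective c (Finite.injective_iff_bijective.mp hc)
    have hσ (i) : c i = σ i := rfl
    simp only [hσ]
    have e₁ := AlternatingMap.map_perm (F.compLinearMap g) (Pi.basisFun R (Fin n)) σ
    have e₂ := AlternatingMap.map_perm (Pi.basisFun R (Fin n)).det (Pi.basisFun R (Fin n)) σ
    simp only [Function.comp_def] at e₁ e₂
    rw [e₁, LinearMap.compAlternatingMap_apply, e₂]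
    rw [Module.Basis.det_self, LinearMap.toSpanSingleton_apply, smul_assoc, one_smul]
    simp
  have h₃ (x : M) : s • x = g (f x) := (LinearMap.congr_fun h x).symm
  rw [h₁]
  simp only [h₃]
  exact AlternatingMap.congr_fun h₂ fun i ↦ f (a i)

/-- Scalars act faithfully on the `n`-th exterior power of a locally free module of rank `n`. -/
theorem eq_of_smul_ιMulti_eq {M : Type*} [AddCommGroup M] [Module R M]
    (hM : Ideal.span {s : R | IsFreeUpTo R M n s} = ⊤) {r r' : R}
    (h : ∀ a : Fin n → M, r • exteriorPower.ιMulti R n a = r' • exteriorPower.ιMulti R n a) :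
    r = r' := by
  rw [← sub_eq_zero, ← Submodule.mem_bot R]
  refine Submodule.mem_of_span_eq_top_of_smul_pow_mem ⊥ _ hM _ ?_
  rintro ⟨s, f, g, -, hfg⟩
  refine ⟨n, (Submodule.mem_bot R).mpr ?_⟩
  have hfg' (x) : f (g x) = s • x := LinearMap.congr_fun hfg x
  have := congr(exteriorPower.alternatingMapLinearEquiv
    ((Pi.basisFun R (Fin n)).det.compLinearMap f) $(h fun i ↦ g (Pi.single i 1)))
  simp only [map_smul, exteriorPower.alternatingMapLinearEquiv_apply_ιMulti,
    AlternatingMap.compLinearMap_apply, hfg', AlternatingMap.map_smul_univ]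
    at this
  have hdet : (Pi.basisFun R (Fin n)).det (fun i ↦ Pi.single i (1 : R)) = 1 := by
    have : (fun i ↦ Pi.single i (1 : R)) = Pi.basisFun R (Fin n) := by
      ext i : 1
      simp
    rw [this, Module.Basis.det_self]
  rw [hdet] at this
  simp only [Finset.prod_const, Finset.card_univ, Fintype.card_fin, smul_eq_mul, mul_one] at this
  rw [smul_eq_mul, mul_sub, mul_comm, this, mul_comm, sub_self]

/-- A symmetric tensor acts on the top exterior power as a scalar. The scalars `t` for which
`t • (x · -)` is a scalar multiplication form an ideal, so the question is local. -/
theorem exists_toExterior_mul_eq_smul (hA : Ideal.span {s : R | IsFreeUpTo R A n s} = ⊤)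
    (x : Fix R A n) : ∃ r : R, ∀ y, toExterior R A n (x * y) = r • toExterior R A n y := by
  let I : Ideal R :=
    { carrier := {t | ∃ r : R, ∀ y, t • toExterior R A n (x * y) = r • toExterior R A n y}
      zero_mem' := ⟨0, by simp⟩
      add_mem' := by
        rintro t t' ⟨r, hr⟩ ⟨r', hr'⟩
        exact ⟨r + r', fun y ↦ by rw [add_smul, add_smul, hr, hr']⟩
      smul_mem' := by
        rintro c t ⟨r, hr⟩
        exact ⟨c * r, fun y ↦ by rw [smul_eq_mul, mul_smul, mul_smul, hr]⟩ }
  suffices h : I = ⊤ by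
    obtain ⟨r, hr⟩ := (Ideal.eq_top_iff_one I).mp h
    exact ⟨r, fun y ↦ by rw [← hr, one_smul]⟩
  rw [← Ideal.radical_eq_top, eq_top_iff, ← hA, Ideal.span_le]
  rintro s ⟨f, g, hgf, -⟩
  have hπ (y : TPow R A n) : ∃ d : R, s ^ n • toExterior R A n y =
      d • exteriorPower.ιMulti R n fun i ↦ g (Pi.single i 1) := by
    induction y using PiTensorProduct.induction_on with
    | smul_tprod r a =>
      refine ⟨r * (Pi.basisFun R (Fin n)).det fun i ↦ f (a i), ?_⟩
      rw [map_smul, smul_comm, toExterior_tprod, pow_smul_alternating hgf, mul_smul]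
    | add y z hy hz =>
      obtain ⟨d, hd⟩ := hy
      obtain ⟨d', hd'⟩ := hz
      exact ⟨d + d', by rw [map_add, smul_add, hd, hd', add_smul]⟩
  obtain ⟨d, hd⟩ := hπ (x * PiTensorProduct.tprod R fun i ↦ g (Pi.single i 1))
  -- One factor `sⁿ` expresses `x · (a₁ ∧ ⋯ ∧ aₙ)` through `x · (g e₁ ∧ ⋯ ∧ g eₙ)`, the other
  -- expresses the latter through `g e₁ ∧ ⋯ ∧ g eₙ`.
  refine ⟨n + n, d * s ^ n, fun y ↦ ?_⟩
  induction y using PiTensorProduct.induction_on with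
  | smul_tprod r a =>
    have h := pow_smul_alternating hgf (mulAlternating hA x) a
    rw [mulAlternating_apply, mulAlternating_apply] at h
    rw [mul_smul_comm, map_smul, map_smul, smul_comm, smul_comm _ r]
    congr 1
    rw [pow_add, mul_smul, h, smul_comm, hd, mul_smul, toExterior_tprod,
      pow_smul_alternating hgf, smul_comm]
  | add y z hy hz => rw [mul_add, map_add, smul_add, hy, hz, map_add, smul_add]

theorem eq_of_smul_toExterior_eq (hA : Ideal.span {s : R | IsFreeUpTo R A n s} = ⊤) {r r' : R}
    (h : ∀ y, r • toExterior R A n y = r' • toExterior R A n y) : r = r' :=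
  eq_of_smul_ιMulti_eq hA fun a ↦ by simpa using h (PiTensorProduct.tprod R a)

/-- The scalars by which symmetric tensors act on `⋀ⁿ A` form an algebra homomorphism. -/
theorem exists_normHom (hA : Ideal.span {s : R | IsFreeUpTo R A n s} = ⊤) :
    ∃ φ : Fix R A n →ₐ[R] R, ∀ (x : Fix R A n) (y : TPow R A n),
      toExterior R A n (x * y) = φ x • toExterior R A n y := by
  choose φ hφ using exists_toExterior_mul_eq_smul hA
  refine ⟨
    { toFun := φ
      map_one' := ?_
      map_mul' := ?_
      map_zero' := ?_
      map_add' := ?_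
      commutes' := ?_ }, hφ⟩
  · exact eq_of_smul_toExterior_eq hA fun y ↦ by rw [← hφ]; simp
  · refine fun x x' ↦ eq_of_smul_toExterior_eq hA fun y ↦ ?_
    rw [← hφ, Subalgebra.coe_mul, mul_assoc, hφ, hφ, mul_smul]
  · exact eq_of_smul_toExterior_eq hA fun y ↦ by rw [← hφ]; simp
  · refine fun x x' ↦ eq_of_smul_toExterior_eq hA fun y ↦ ?_
    rw [← hφ, Subalgebra.coe_add, add_mul, map_add, hφ, hφ, add_smul]
  · refine fun r ↦ eq_of_smul_toExterior_eq hA fun y ↦ ?_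
    rw [← hφ, Subalgebra.coe_algebraMap, Algebra.algebraMap_eq_smul_one, smul_mul_assoc, one_mul,
      map_smul, Algebra.algebraMap_self_apply]

theorem isNorm_of_toExterior_mul {φ : Fix R A n →ₐ[R] R}
    (hφ : ∀ (x : Fix R A n) (y : TPow R A n),
      toExterior R A n (x * y) = φ x • toExterior R A n y) (a : A) :
    IsNorm R A n a (φ (diag R n a)) := fun v ↦ by
  have := hφ (diag R n a) (PiTensorProduct.tprod R v)
  rwa [diag, PiTensorProduct.tprod_mul_tprod, toExterior_tprod, toExterior_tprod] at this

end NormHom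

/-! ### Compatibility with base change -/

section BaseChange

variable {R : Type*} [CommRing R] {A : Type*} [CommRing A] [Algebra R A] {n : ℕ}
  (R' : Type*) [CommRing R'] [Algebra R R']

theorem exists_linearMap_exteriorPower {N : Type*} [AddCommGroup N] [Module R' N] [Module R N]
    [IsScalarTower R R' N] (G : (R' ⊗[R] A) [⋀^Fin n]→ₗ[R'] N) :
    ∃ Λ : ⋀[R]^n A →ₗ[R] N, ∀ a, Λ (exteriorPower.ιMulti R n a) = G fun i ↦ 1 ⊗ₜ a i :=
  ⟨exteriorPower.alternatingMapLinearEquiv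
    { (G.toMultilinearMap.restrictScalars R).compLinearMap
        fun _ ↦ (Algebra.TensorProduct.includeRight : A →ₐ[R] R' ⊗[R] A).toLinearMap with
      map_eq_zero_of_eq' := fun a i j h hij ↦ G.map_eq_zero_of_eq _ (by simp [h]) hij },
    fun a ↦ exteriorPower.alternatingMapLinearEquiv_apply_ιMulti _ a⟩

/-- The canonical additive map `⋀ⁿ_R A → ⋀ⁿ_{R'} (R' ⊗ A)`. Its linearity is stated through
`algebraMap R R'`, as the target is only an `R'`-module. -/
theorem exists_exterior_baseChange :
    ∃ Λ : ⋀[R]^n A →+ ⋀[R']^n (R' ⊗[R] A), (∀ (r : R) (z), Λ (r • z) = algebraMap R R' r • Λ z) ∧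
      ∀ y : TPow R A n, toExterior R' (R' ⊗[R] A) n (bcTPow R A n R' y) =
        Λ (toExterior R A n y) := by
  -- Restriction of scalars along `R → R'`, a local structure that is passed explicitly below.
  let inst : Module R (⋀[R']^n (R' ⊗[R] A)) := Module.compHom _ (algebraMap R R')
  have tower : @IsScalarTower R R' (⋀[R']^n (R' ⊗[R] A)) _ _ inst.toSMul :=
    @IsScalarTower.of_algebraMap_smul R R' _ _ _ _ _ inst.toSMul fun _ _ ↦ rfl
  obtain ⟨Λ, hΛ⟩ := @exists_linearMap_exteriorPower R _ A _ _ n R' _ _ _ _ _ inst tower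
    (exteriorPower.ιMulti R' n)
  have hsmul (r : R) (z) : Λ (r • z) = algebraMap R R' r • Λ z := Λ.map_smul r z
  refine ⟨Λ.toAddMonoidHom, hsmul, fun y ↦ ?_⟩
  change _ = Λ _
  induction y using PiTensorProduct.induction_on with
  | smul_tprod r a =>
    rw [map_smul (bcTPow R A n R'), map_smul (toExterior R A n), hsmul, toExterior_tprod, hΛ,
      ← algebraMap_smul R' r (bcTPow R A n R' _), map_smul (toExterior R' (R' ⊗[R] A) n),
      bcTPow_tprod, toExterior_tprod]
  | add y z hy hz =>
    rw [map_add, map_add, map_add, hy, hz]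
    exact (Λ.map_add _ _).symm

theorem conj_one_tmul (a : A) (i : Fin n) :
    conj R' n ((1 : R') ⊗ₜ[R] a) i = bcTPow R A n R' (conj R n a i) := by
  rw [conj_def, conj_def, bcTPow_tprod]
  congr 1
  funext j
  by_cases hj : j = i
  · subst hj
    simp
  · simp [hj, Algebra.TensorProduct.one_def]

theorem span_range_bcTPow :
    Submodule.span R' (Set.range (bcTPow R A n R')) = ⊤ := by
  let H : Submonoid (TPow R' (R' ⊗[R] A) n) := (bcTPow R A n R').range.toSubsemiring.toSubmonoid
  have hH : (H : Set (TPow R' (R' ⊗[R] A) n)) = Set.range (bcTPow R A n R') :=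
    AlgHom.coe_range _
  -- The image is closed under products, so its span is the subalgebra that it generates.
  have hclosure : (Submonoid.closure (Set.range (bcTPow R A n R')) : Set _) =
      Set.range (bcTPow R A n R') := by
    rw [← hH, Submonoid.closure_eq]
  rw [← hclosure, ← Algebra.adjoin_eq_span, ← Algebra.top_toSubmodule]
  congr 1
  rw [eq_top_iff]
  rintro y -
  induction y using PiTensorProduct.induction_on with
  | smul_tprod r v =>
    refine Subalgebra.smul_mem _ ?_ r
    rw [← prod_conj]
    refine prod_mem fun i _ ↦ ?_
    induction v i using TensorProduct.induction_on with
    | zero => rw [conj, map_zero]; exact zero_mem _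
    | tmul t a =>
      have h : conj R' n (t ⊗ₜ[R] a) i = t • bcTPow R A n R' (conj R n a i) := by
        have h₁ : t ⊗ₜ[R] a = t • ((1 : R') ⊗ₜ[R] a) := by
          rw [TensorProduct.smul_tmul', smul_eq_mul, mul_one]
        rw [h₁, ← conj_one_tmul]
        exact map_smul (PiTensorProduct.singleAlgHom (R := R') (A := fun _ : Fin n ↦ R' ⊗[R] A) i) _ _
      rw [h]
      exact Subalgebra.smul_mem _ (Algebra.subset_adjoin (Set.mem_range_self _)) t
    | add a b ha hb =>
      rw [conj] at ha hb ⊢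
      rw [map_add]
      exact add_mem ha hb
  | add y z hy hz => exact add_mem hy hz

theorem normHom_bcFix (hA : Ideal.span {s : R | IsFreeUpTo R A n s} = ⊤) {φ : Fix R A n →ₐ[R] R}
    (hφ : ∀ (x : Fix R A n) (y : TPow R A n),
      toExterior R A n (x * y) = φ x • toExterior R A n y)
    {φ' : Fix R' (R' ⊗[R] A) n →ₐ[R'] R'}
    (hφ' : ∀ (x : Fix R' (R' ⊗[R] A) n) (y : TPow R' (R' ⊗[R] A) n),
      toExterior R' (R' ⊗[R] A) n (x * y) = φ' x • toExterior R' (R' ⊗[R] A) n y)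
    (x : Fix R A n) : φ' (bcFix R A n R' x) = algebraMap R R' (φ x) := by
  obtain ⟨Λ, hΛ, hΛπ⟩ := exists_exterior_baseChange (R := R) (A := A) (n := n) R'
  refine eq_of_smul_toExterior_eq (span_isFreeUpTo_baseChange hA R') fun y ↦ ?_
  induction (span_range_bcTPow (R := R) (A := A) (n := n) R' ▸ Submodule.mem_top :
    y ∈ Submodule.span R' (Set.range (bcTPow R A n R'))) using Submodule.span_induction with
  | mem y hy =>
    obtain ⟨y, rfl⟩ := hy
    rw [← hφ', bcFix, ← map_mul, hΛπ, hΛπ, hφ, hΛ]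
  | zero => simp
  | add y z _ _ hy hz => rw [map_add, smul_add, smul_add, hy, hz]
  | smul r y _ hy => rw [map_smul, smul_comm, hy, smul_comm]

end BaseChange

theorem exists_isFerrand {R : Type u} [CommRing R] {A : Type v} [CommRing A] [Algebra R A] {n : ℕ}
    (hA : Ideal.span {s : R | IsFreeUpTo R A n s} = ⊤) :
    ∃ φ : Fix R A n →ₐ[R] R, IsFerrand φ := by
  obtain ⟨φ, hφ⟩ := exists_normHom hA
  refine ⟨φ, fun R' _ _ ↦ ?_⟩
  obtain ⟨φ', hφ'⟩ := exists_normHom (span_isFreeUpTo_baseChange hA R')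
  exact ⟨φ', normHom_bcFix R' hA hφ hφ', isNorm_of_toExterior_mul hφ'⟩

/-! ### Characteristic polynomials from symmetric tensors -/

section Charpoly

theorem IsNorm.map {R : Type*} [CommRing R] {A B : Type*} [CommRing A] [CommRing B] [Algebra R A]
    [Algebra R B] {n : ℕ} {a : A} {r : R} (h : IsNorm R A n a r) (ε : A ≃ₐ[R] B) :
    IsNorm R B n (ε a) r := fun v ↦ by
  have := congr(exteriorPower.map n ε.toLinearMap $(h fun i ↦ ε.symm (v i)))
  simpa [Function.comp_def] using this

theorem IsNorm.unique {R : Type*} [CommRing R] {A : Type*} [CommRing A] [Algebra R A] {n : ℕ}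
    (hA : Ideal.span {s : R | IsFreeUpTo R A n s} = ⊤) {a : A} {r r' : R}
    (h : IsNorm R A n a r) (h' : IsNorm R A n a r') : r = r' :=
  eq_of_smul_ιMulti_eq hA fun v ↦ by rw [← h v, ← h' v]

variable {R : Type*} [CommRing R] {A : Type*} [CommRing A] [Algebra R A] {n : ℕ}

/-- The characteristic polynomial can be computed in `R[X] ⊗ A` in place of `A[X]`. -/
theorem isCharpoly_iff_isNorm (a : A) (P : R[X]) :
    IsCharpoly R A n a P ↔
      IsNorm R[X] (R[X] ⊗[R] A) n (algebraMap R[X] _ Polynomial.X - 1 ⊗ₜ a) P := by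
  let _ : Algebra R[X] A[X] := Polynomial.algebra R A
  let ε : R[X] ⊗[R] A ≃ₐ[R[X]] A[X] := Algebra.IsPushout.equiv R R[X] A A[X]
  have hε : ε (algebraMap R[X] _ Polynomial.X - 1 ⊗ₜ a) = Polynomial.X - Polynomial.C a := by
    rw [map_sub, AlgEquiv.commutes, Algebra.IsPushout.equiv_tmul, map_one, one_mul]
    simp [Polynomial.algebraMap_def]
  constructor
  · intro h
    have := IsNorm.map h ε.symm
    rwa [← hε, AlgEquiv.symm_apply_apply] at this
  · intro h
    have := h.map ε
    rwa [hε] at this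

theorem IsCharpoly.unique (hA : Ideal.span {s : R | IsFreeUpTo R A n s} = ⊤) {a : A}
    {P Q : R[X]} (hP : IsCharpoly R A n a P) (hQ : IsCharpoly R A n a Q) : P = Q :=
  IsNorm.unique (span_isFreeUpTo_baseChange hA R[X]) ((isCharpoly_iff_isNorm a P).mp hP)
    ((isCharpoly_iff_isNorm a Q).mp hQ)

theorem prod_sub_eq_sum_esymm {B : Type*} [CommRing B] (x : B) (y : Fin n → B) :
    ∏ i, (x - y i) = ∑ k ∈ Finset.range (n + 1), (-1) ^ k * x ^ (n - k) *
      ∑ t ∈ Finset.powersetCard k Finset.univ, ∏ i ∈ t, y i := by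
  have h (i : Fin n) : x - y i = -y i + x := by ring
  simp only [h]
  rw [Finset.prod_add, Finset.sum_powerset, Finset.card_univ, Fintype.card_fin]
  refine Finset.sum_congr rfl fun k _ ↦ ?_
  rw [Finset.mul_sum]
  refine Finset.sum_congr rfl fun t ht ↦ ?_
  have ht' := (Finset.mem_powersetCard.mp ht).2
  rw [Finset.prod_neg, Finset.prod_const, Finset.card_sdiff_of_subset (Finset.subset_univ t), ht',
    Finset.card_univ, Fintype.card_fin]
  ring

/-- The diagonal tensor of `x - a` is the product of the `x - a⁽ⁱ⁾`, expanded in the `e_k(a)`. -/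
theorem diag_algebraMap_sub (R' : Type*) [CommRing R'] [Algebra R R'] (x : R') (a : A) :
    diag R' n (algebraMap R' (R' ⊗[R] A) x - 1 ⊗ₜ a) =
      ∑ k ∈ Finset.range (n + 1), ((-1) ^ k * x ^ (n - k)) • bcFix R A n R' (e R n k a) := by
  apply Subtype.ext
  change PiTensorProduct.tprod R' _ = _
  rw [← prod_conj]
  have h (i : Fin n) : conj R' n (algebraMap R' (R' ⊗[R] A) x - 1 ⊗ₜ a) i =
      algebraMap R' _ x - bcTPow R A n R' (conj R n a i) := by
    rw [← conj_one_tmul, conj, map_sub, AlgHom.commutes]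
    rfl
  simp only [h]
  rw [prod_sub_eq_sum_esymm, AddSubmonoidClass.coe_finsetSum]
  refine Finset.sum_congr rfl fun k _ ↦ ?_
  rw [Subalgebra.coe_smul]
  change _ = _ • bcTPow R A n R' (e R n k a : TPow R A n)
  rw [coe_e, Algebra.smul_def]
  simp only [map_mul, map_pow, map_neg, map_one, map_sum, map_prod]

/-- The polynomial `∑ₖ (-1)ᵏ φ(e_k(a)) X^{n-k}`. -/
def charpolyOf (φ : Fix R A n →ₐ[R] R) (a : A) : R[X] :=
  ∑ k ∈ Finset.range (n + 1), (-1) ^ k * Polynomial.X ^ (n - k) * Polynomial.C (φ (e R n k a))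

theorem coeff_charpolyOf (φ : Fix R A n →ₐ[R] R) (a : A) {k : ℕ} (hk : k ≤ n) :
    (charpolyOf φ a).coeff (n - k) = (-1) ^ k * φ (e R n k a) := by
  rw [charpolyOf, Polynomial.finsetSum_coeff, Finset.sum_eq_single k]
  · rw [← Polynomial.C_1, ← Polynomial.C_neg, ← Polynomial.C_pow, Polynomial.coeff_mul_C,
      Polynomial.coeff_C_mul, Polynomial.coeff_X_pow_self, mul_one]
  · intro l hl hlk
    have := Finset.mem_range.mp hl
    rw [← Polynomial.C_1, ← Polynomial.C_neg, ← Polynomial.C_pow, Polynomial.coeff_mul_C,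
      Polynomial.coeff_C_mul, Polynomial.coeff_X_pow, if_neg (by omega), mul_zero, zero_mul]
  · intro h
    exact absurd (Finset.mem_range.mpr (by omega)) h

end Charpoly

/-! ### The Ferrand homomorphism -/

section Ferrand

variable {R : Type u} [CommRing R] {A : Type v} [CommRing A] [Algebra R A] {n : ℕ}

/-- Evaluate the base change of `φ` to `R[X]` on the diagonal tensor of `X - a`. -/
theorem IsFerrand.isCharpoly {φ : Fix R A n →ₐ[R] R} (hφ : IsFerrand φ) (a : A) :
    IsCharpoly R A n a (charpolyOf φ a) := by
  obtain ⟨φ', hφφ', hnorm⟩ := hφ R[X]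
  rw [isCharpoly_iff_isNorm]
  convert hnorm _
  rw [diag_algebraMap_sub, map_sum, charpolyOf]
  refine Finset.sum_congr rfl fun k _ ↦ ?_
  rw [map_smul, hφφ', smul_eq_mul]
  rfl

theorem IsFerrand.isS {φ : Fix R A n →ₐ[R] R} (hφ : IsFerrand φ) (a : A) {k : ℕ} (hk : k ≤ n) :
    IsS R A n k a (φ (e R n k a)) := by
  refine ⟨charpolyOf φ a, hφ.isCharpoly a, ?_⟩
  rw [coeff_charpolyOf φ a hk, ← mul_assoc, ← mul_pow]
  simp

theorem IsS.unique (hA : Ideal.span {s : R | IsFreeUpTo R A n s} = ⊤) {a : A} {k : ℕ} {s t : R}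
    (hs : IsS R A n k a s) (ht : IsS R A n k a t) : s = t := by
  obtain ⟨P, hP, rfl⟩ := hs
  obtain ⟨Q, hQ, rfl⟩ := ht
  rw [hP.unique hA hQ]

theorem algHom_ext_of_isS (hA : Ideal.span {s : R | IsFreeUpTo R A n s} = ⊤)
    {φ ψ : Fix R A n →ₐ[R] R}
    (hφ : ∀ (a : A) (k : ℕ), 1 ≤ k → k ≤ n → IsS R A n k a (φ (e R n k a)))
    (hψ : ∀ (a : A) (k : ℕ), 1 ≤ k → k ≤ n → IsS R A n k a (ψ (e R n k a))) : φ = ψ := by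
  refine AlgHom.ext_of_adjoin_eq_top (adjoin_e_eq_top R n hA) ?_
  rintro _ ⟨k, a, rfl⟩
  -- `e₀(a) = 1`, and `e_k(a) = 0` for `k > n`.
  rcases Nat.eq_zero_or_pos k with rfl | hk
  · have : e R n 0 a = 1 := Subtype.ext (by simp [coe_e])
    rw [this, map_one, map_one]
  rcases le_or_gt k n with hkn | hkn
  · exact (hφ a k hk hkn).unique hA (hψ a k hk hkn)
  · have : e R n k a = 0 := Subtype.ext (by
      rw [coe_e, Finset.powersetCard_eq_empty.mpr (by simpa using hkn)]
      rfl)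
    rw [this, map_zero, map_zero]

end Ferrand

end Ferrand

end

theorem mainTheorem11 {R : Type u} [CommRing R] {A : Type v} [CommRing A] [Algebra R A] (n : ℕ)
    (hA : Ferrand.LocallyFreeOfRank R A n) :
    (∀ a : A, ∃! P : Polynomial R, Ferrand.IsCharpoly R A n a P) ∧
    (∃! φ : Ferrand.Fix R A n →ₐ[R] R, Ferrand.IsFerrand φ) ∧
    ∀ φ : Ferrand.Fix R A n →ₐ[R] R, Ferrand.IsFerrand φ →
      (∀ (a : A) (k : ℕ), 1 ≤ k → k ≤ n → Ferrand.IsS R A n k a (φ (Ferrand.e R n k a))) ∧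
      ∀ ψ : Ferrand.Fix R A n →ₐ[R] R,
        (∀ (a : A) (k : ℕ), 1 ≤ k → k ≤ n → Ferrand.IsS R A n k a (ψ (Ferrand.e R n k a))) →
        ψ = φ := by
  have hspan := hA.span_isFreeUpTo
  obtain ⟨φ₀, hφ₀⟩ := Ferrand.exists_isFerrand hspan
  have hS {φ : Ferrand.Fix R A n →ₐ[R] R} (hφ : Ferrand.IsFerrand φ) (a : A) (k : ℕ) (_ : 1 ≤ k)
      (hk : k ≤ n) : Ferrand.IsS R A n k a (φ (Ferrand.e R n k a)) := hφ.isS a hk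
  exact ⟨fun a ↦ ⟨_, hφ₀.isCharpoly a, fun _ hP ↦ hP.unique hspan (hφ₀.isCharpoly a)⟩,
    ⟨φ₀, hφ₀, fun φ hφ ↦ Ferrand.algHom_ext_of_isS hspan (hS hφ) (hS hφ₀)⟩,
    fun φ hφ ↦ ⟨hS hφ, fun ψ hψ ↦ Ferrand.algHom_ext_of_isS hspan hψ (hS hφ)⟩⟩
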